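/- A $\mu$Stipula contract consists of an initial state and a finite sequence of functions. A function $@Q\; f\,\{W\} \Rightarrow @Q'$ has an initial state $Q$, a name $f$, a final state $Q'$ and a body $W$, a finite sequence of events $\mathtt{now}+k \gg @P \Rightarrow @P'$ with $k\in\mathbb N$. State and function names are taken from a countably infinite set; functions of a contract are uniquely determined by the triples $Q\,f\,Q'$, and each event of the contract has its own line code $n$, so it is uniquely determined by the triple $P\,\mathtt{ev}_n\,P'$; these triples are the clauses of the contract. A configuration $(Q,\Sigma,\Psi),t$ consists of the current state $Q$, a component $\Sigma$ that is either empty ($-$) or a continuation $\Psi' \Rightarrow Q'$ with $\Psi'$ a finite multiset of pending events, a finite multiset $\Psi$ of pending events $k\gg_n P\Rightarrow P'$, and a clock $t\in\mathbb N$. Write $\mathrm{nored}(\Psi,Q)$ if $\Psi$ contains no event $0\gg_n Q\Rightarrow Q'$ (for any $n$, $Q'$), and let $\Psi{\downarrow}$ be obtained from $\Psi$ by deleting all events with time value $0$ and decreasing the time value of all others by $1$. The transitions are: - Function: $(Q,-,\Psi),t \xrightarrow{f} (Q,\Psi'\Rightarrow Q',\Psi),t$ if $@Q\;f\,\{W\}\Rightarrow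 @Q'$ is a function of the contract, $\mathrm{nored}(\Psi,Q)$ holds, and $\Psi'$ is the multiset of the events $k\gg_n P\Rightarrow P'$ for the events $\mathtt{now}+k\gg @P\Rightarrow @P'$ of $W$ with line code $n$; - Event-Match: $(Q,-,\,0\gg_n Q\Rightarrow Q' \mid \Psi'),t \xrightarrow{\mathtt{ev}_n} (Q,\,-\Rightarrow Q',\,\Psi'),t$; - State-Change: $(Q,\Psi'\Rightarrow Q',\Psi),t \rightarrow (Q',-,\Psi'\mid\Psi),t$; - Tick: $(Q,-,\Psi),t\rightarrow (Q,-,\Psi{\downarrow}),t+1$ if $\mathrm{nored}(\Psi,Q)$ holds. The initial configuration is $(Q_0,-,-),0$ with $Q_0$ the initial state of the contract. A state $Q$ is reachable if some configuration $(Q,-,\Psi),t$ is reachable from the initial one by finitely many (possibly zero) transitions. A clause $Q\,f\,Q'$ (respectively $Q\,\mathtt{ev}_n\,Q'$) is reachable if from some reachable configuration with state $Q$ there is a transition with label $f$ (respectively $\mathtt{ev}_n$) that produces a continuation $\Psi'\Rightarrow Q'$. A contract is instantaneous (belongs to $\mu\mathrm{Stipula}^{\mathtt I}$) if all time expressions of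 its events are $\mathtt{now}+0$. **Theorem.** State reachability and clause reachability are undecidable for $\mu\mathrm{Stipula}^{\mathtt I}$. That is: there is no algorithm that, given an instantaneous $\mu$Stipula contract $C$ and a state $Q$, decides whether $Q$ is reachable in $C$; and there is no algorithm that, given an instantaneous $\mu$Stipula contract $C$ and a clause of $C$, decides whether this clause is reachable in $C$. The latter already holds for clauses that are functions, and it already holds for clauses that are events. -/

import Mathlib

/-! The calculus `μStipula`: syntax, labelled transition semantics, reachability of states and of
clauses, and the notion of decidability of a problem restricted to a set of instances. -/

namespace MuStipula

/-- State names, function names and line codes are natural numbers. -/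
abbrev StateName := ℕ
abbrev FunName := ℕ
abbrev LineCode := ℕ

/-! ### Syntax -/

/-- An event definition `now + delay >> @src => @tgt`. -/
structure EventDef where
  delay : ℕ
  src : StateName
  tgt : StateName

/-- A function definition `@src name { body } => @tgt`. -/
structure FunDef where
  src : StateName
  name : FunName
  body : List EventDef
  tgt : StateName

/-- A contract `stipula C { init Q  F }`: the initial state and the sequence of functions. -/
structure Contract where
  init : StateName
  functions : List FunDef

/-- Clauses: functions, as triples `Q f Q'`, and events, as triples `Q ev_n Q'` where `n` is the
line code of the event. -/
inductive Clause where
  | func (src : StateName) (f : FunName) (tgt : StateName)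
  | event (src : StateName) (n : LineCode) (tgt : StateName)

/-- The function clauses `Q f Q'` of a contract, in textual order. -/
def Contract.funClauses (C : Contract) : List Clause :=
  C.functions.map fun F => Clause.func F.src F.name F.tgt

/-- The event clauses `Q ev_n Q'` of a contract. The line code of an event is its position
(starting from `0`) in the textual sequence of all the event definitions of the contract, so that
distinct event definitions have distinct line codes. -/
def Contract.eventClauses (C : Contract) : List Clause :=
  (C.functions.flatMap FunDef.body).zipIdx.map fun p => Clause.event p.1.src p.2 p.1.tgt

/-- The standing assumption on contracts: a function is uniquely determined by its initial state,
its name and its final state. -/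
def Contract.WellFormed (C : Contract) : Prop := C.funClauses.Nodup

/-- The instantaneous fragment: every time expression is `now + 0`. -/
def Contract.Instantaneous (C : Contract) : Prop :=
  ∀ F ∈ C.functions, ∀ e ∈ F.body, e.delay = 0

/-! ### Semantics -/

/-- A pending event `time >>_line src => tgt`. -/
structure Pending where
  time : ℕ
  line : LineCode
  src : StateName
  tgt : StateName

/-- The number of event definitions that precede the `i`-th function of the contract. -/
def Contract.offset (C : Contract) (i : ℕ) : ℕ :=
  ((C.functions.take i).map fun F => F.body.length).sum

/-- The multiset of pending events obtained from the body `W` of the `i`-th function of the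
contract: `now` is dropped and every event gets its line code. -/
def Contract.linecode (C : Contract) (i : ℕ) (W : List EventDef) : Multiset Pending :=
  ((W.zipIdx (C.offset i)).map fun p => Pending.mk p.1.delay p.2 p.1.src p.1.tgt : List Pending)

/-- No pending event of `Ψ` can be triggered in the state `Q`. -/
def NoRed (Ψ : Multiset Pending) (Q : StateName) : Prop :=
  ∀ e ∈ Ψ, e.time ≠ 0 ∨ e.src ≠ Q

/-- `e ↓` for a single pending event: it is dropped if its time value is `0`, otherwise its time
value is decreased by one. -/
def Pending.down (e : Pending) : Option Pending :=
  match e.time with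
  | 0 => none
  | t + 1 => some ⟨t, e.line, e.src, e.tgt⟩

/-- `Ψ ↓`. -/
def down (Ψ : Multiset Pending) : Multiset Pending :=
  Ψ.filterMap Pending.down

/-- Configurations `C(Q, Σ, Ψ), t` of a contract: `body` is `none` for an empty `Σ`, and
`some (Ψ', Q')` for a continuation `Ψ' => Q'`. -/
structure Config where
  state : StateName
  body : Option (Multiset Pending × StateName)
  pending : Multiset Pending
  clock : ℕ

/-- Labels of transitions: empty, a function name, or `ev_n`. -/
inductive Label where
  | silent
  | func (f : FunName)
  | event (n : LineCode)

/-- The labelled transition relation of a contract. -/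
inductive Step (C : Contract) : Config → Label → Config → Prop where
  | function (i : ℕ) (F : FunDef) (Ψ : Multiset Pending) (t : ℕ)
      (hF : C.functions[i]? = some F) (hΨ : NoRed Ψ F.src) :
      Step C ⟨F.src, none, Ψ, t⟩ (Label.func F.name)
        ⟨F.src, some (C.linecode i F.body, F.tgt), Ψ, t⟩
  | stateChange (Q Q' : StateName) (Ψ' Ψ : Multiset Pending) (t : ℕ) :
      Step C ⟨Q, some (Ψ', Q'), Ψ, t⟩ Label.silent ⟨Q', none, Ψ' + Ψ, t⟩
  | eventMatch (n : LineCode) (Q Q' : StateName) (Ψ' : Multiset Pending) (t : ℕ) :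
      Step C ⟨Q, none, (⟨0, n, Q, Q'⟩ : Pending) ::ₘ Ψ', t⟩ (Label.event n)
        ⟨Q, some (0, Q'), Ψ', t⟩
  | tick (Q : StateName) (Ψ : Multiset Pending) (t : ℕ) (hΨ : NoRed Ψ Q) :
      Step C ⟨Q, none, Ψ, t⟩ Label.silent ⟨Q, none, down Ψ, t + 1⟩

/-- The initial configuration: no continuation, no pending events, clock `0`. -/
def Contract.initConfig (C : Contract) : Config := ⟨C.init, none, 0, 0⟩

/-- `c` is reachable by a (possibly empty) computation from the initial configuration. -/
def Contract.ConfigReachable (C : Contract) (c : Config) : Prop :=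
  Relation.ReflTransGen (fun c₁ c₂ => ∃ μ, Step C c₁ μ c₂) C.initConfig c

/-- State reachability. -/
def Contract.StateReachable (C : Contract) (Q : StateName) : Prop :=
  ∃ (Ψ : Multiset Pending) (t : ℕ), C.ConfigReachable ⟨Q, none, Ψ, t⟩

/-- The transition `c₁ → c₂` of `C` is an execution of the given clause: it has the label of the
clause, starts from the initial state of the clause, and its continuation leads to the final state
of the clause. -/
def Executes (C : Contract) (c₁ c₂ : Config) : Clause → Prop
  | .func Q f Q' => Step C c₁ (Label.func f) c₂ ∧ c₁.state = Q ∧ ∃ Ψ, c₂.body = some (Ψ, Q')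
  | .event Q n Q' => Step C c₁ (Label.event n) c₂ ∧ c₁.state = Q ∧ ∃ Ψ, c₂.body = some (Ψ, Q')

/-- Clause reachability: some computation from the initial configuration executes the clause. -/
def Contract.ClauseReachable (C : Contract) (c : Clause) : Prop :=
  ∃ c₁ c₂ : Config, C.ConfigReachable c₁ ∧ Executes C c₁ c₂ c

/-! ### Finite encodings of instances, and decidability -/

/-- Events as tuples `(delay, src, tgt)`. -/
def EventDef.equivTuple : EventDef ≃ ℕ × ℕ × ℕ where
  toFun e := (e.delay, e.src, e.tgt)
  invFun p := ⟨p.1, p.2.1, p.2.2⟩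
  left_inv _ := rfl
  right_inv _ := rfl

instance : Primcodable EventDef := Primcodable.ofEquiv _ EventDef.equivTuple

/-- Functions as tuples `(src, name, body, tgt)`. -/
def FunDef.equivTuple : FunDef ≃ ℕ × ℕ × List EventDef × ℕ where
  toFun F := (F.src, F.name, F.body, F.tgt)
  invFun p := ⟨p.1, p.2.1, p.2.2.1, p.2.2.2⟩
  left_inv _ := rfl
  right_inv _ := rfl

instance : Primcodable FunDef := Primcodable.ofEquiv _ FunDef.equivTuple

/-- Contracts as pairs `(init, functions)`. -/
def Contract.equivTuple : Contract ≃ ℕ × List FunDef where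
  toFun C := (C.init, C.functions)
  invFun p := ⟨p.1, p.2⟩
  left_inv _ := rfl
  right_inv _ := rfl

instance : Primcodable Contract := Primcodable.ofEquiv _ Contract.equivTuple

/-- Clauses as tagged triples. -/
def Clause.equivSum : Clause ≃ (ℕ × ℕ × ℕ) ⊕ (ℕ × ℕ × ℕ) where
  toFun
    | .func Q f Q' => Sum.inl (Q, f, Q')
    | .event Q n Q' => Sum.inr (Q, n, Q')
  invFun
    | .inl p => .func p.1 p.2.1 p.2.2
    | .inr p => .event p.1 p.2.1 p.2.2
  left_inv c := by cases c <;> rfl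
  right_inv s := by cases s <;> rfl

instance : Primcodable Clause := Primcodable.ofEquiv _ Clause.equivSum

/-- The problem `P`, restricted to the instances in `S`, is decidable: there is an algorithm that
terminates on every instance in `S` with the correct answer (its behaviour on other inputs, where
it may also diverge, does not matter). -/
def DecidableOn {α : Type} [Primcodable α] (S : Set α) (P : α → Prop) : Prop :=
  ∃ f : α →. Bool, Partrec f ∧ ∀ a ∈ S, ∃ b ∈ f a, (b = true ↔ P a)

/-- The contracts of the instantaneous fragment. -/
def InstantaneousContracts : Set Contract := {C | C.WellFormed ∧ C.Instantaneous}

end MuStipula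

/-! ### Counter programs -/

namespace CounterProgram

open Function

/-- Structured programs over registers; `loop r c` is `while r > 0 do (r := r - 1; c)`. -/
inductive Cmd where
  | skip
  | inc (r : ℕ)
  | seq (c d : Cmd)
  | loop (r : ℕ) (c : Cmd)

/-- The contents of the registers. -/
abbrev Regs := ℕ → ℕ

/-- Terminating executions of structured programs. -/
inductive Exec : Cmd → Regs → Regs → Prop where
  | skip (s : Regs) : Exec .skip s s
  | inc (r : ℕ) (s : Regs) : Exec (.inc r) s (update s r (s r + 1))
  | seq {c d : Cmd} {s₁ s₂ s₃ : Regs} :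
      Exec c s₁ s₂ → Exec d s₂ s₃ → Exec (.seq c d) s₁ s₃
  | loopZero {r : ℕ} {c : Cmd} {s : Regs} : s r = 0 → Exec (.loop r c) s s
  | loopSucc {r : ℕ} {c : Cmd} {s₁ s₂ s₃ : Regs} : s₁ r ≠ 0 →
      Exec c (update s₁ r (s₁ r - 1)) s₂ → Exec (.loop r c) s₂ s₃ → Exec (.loop r c) s₁ s₃

theorem Exec.cast {c : Cmd} {s s₁ s₂ : Regs} (h : Exec c s s₁) (e : s₁ = s₂) : Exec c s s₂ :=
  e ▸ h

theorem Exec.cast_both {c : Cmd} {s s' s₁ s₂ : Regs} (h : Exec c s s₁) (e : s = s')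
    (e' : s₁ = s₂) : Exec c s' s₂ :=
  e ▸ e' ▸ h

theorem Exec.loop_of_family {r : ℕ} {c : Cmd} (N : ℕ) (σ : ℕ → Regs)
    (hr : ∀ k ≤ N, σ k r = N - k)
    (hstep : ∀ k < N, Exec c (update (σ k) r (N - k - 1)) (σ (k + 1))) :
    Exec (.loop r c) (σ 0) (σ N) := by
  suffices h : ∀ d k, k + d = N → Exec (.loop r c) (σ k) (σ N) from h N 0 (by omega)
  intro d
  induction d with
  | zero =>
    rintro k rfl
    exact .loopZero (by simpa using hr k le_rfl)
  | succ d ih =>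
    intro k hk
    have h := hr k (by omega)
    refine .loopSucc (by omega) ?_ (ih (k + 1) (by omega))
    rw [h]
    exact hstep k (by omega)

/-- Set a register to zero. -/
def clear (r : ℕ) : Cmd := .loop r .skip

theorem exec_clear (r : ℕ) (s : Regs) : Exec (clear r) s (update s r 0) := by
  have h := Exec.loop_of_family (r := r) (c := .skip) (s r) (fun k => update s r (s r - k))
    (by simp) (fun k _ => by
      simpa [Nat.sub_sub] using Exec.skip _)
  simpa [clear] using h

/-- Copy register `r` to register `o`, using the register `m` as scratch space. -/
def copy (r o m : ℕ) : Cmd :=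
  .seq (clear o) (.seq (.loop r (.seq (.inc o) (.inc m))) (.loop m (.inc r)))

theorem exec_copy {r o m : ℕ} (hro : r ≠ o) (hrm : r ≠ m) (hom : o ≠ m) (s : Regs)
    (hm : s m = 0) : Exec (copy r o m) s (update s o (s r)) := by
  refine .seq (exec_clear o s) (.seq
    (s₂ := update (update (update s o (s r)) m (s r)) r 0) ?_ ?_)
  · have h := Exec.loop_of_family (r := r) (c := .seq (.inc o) (.inc m)) (s r)
      (fun k => update (update (update s o k) m k) r (s r - k)) (by simp) (fun k _ => by
        refine .seq (.inc _ _) ((Exec.inc _ _).cast ?_)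
        funext x
        simp only [update_apply]
        split_ifs <;> omega)
    refine h.cast_both ?_ ?_
    · funext x
      simp only [update_apply]
      split_ifs <;> simp_all
    · simp
  · have h := Exec.loop_of_family (r := m) (c := .inc r) (s r)
      (fun k => update (update (update s o (s r)) r k) m (s r - k)) (by simp) (fun k _ => by
        refine (Exec.inc _ _).cast ?_
        funext x
        simp only [update_apply]
        split_ifs <;> omega)
    refine h.cast_both ?_ ?_
    · funext x
      simp only [update_apply]
      split_ifs <;> simp_all
    · funext x
      simp only [update_apply]
      split_ifs <;> simp_all

theorem exists_clear_range (m k : ℕ) :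
    ∃ c, ∀ s, Exec c s (fun r => if m ≤ r ∧ r < m + k then 0 else s r) := by
  induction k with
  | zero => exact ⟨.skip, fun s => (Exec.skip s).cast (by funext r; rw [if_neg (by omega)])⟩
  | succ k ih =>
    obtain ⟨c, hc⟩ := ih
    refine ⟨.seq c (clear (m + k)), fun s => .seq (hc s) ((exec_clear _ _).cast ?_)⟩
    funext r
    simp only [update_apply]
    split_ifs <;> first | rfl | omega

/-- The function `f` can be computed from arbitrary input registers `xs` into an arbitrary output
register `o`, if all registers from `m` on are available as scratch space. -/
def Implementable {n : ℕ} (f : List.Vector ℕ n → ℕ) : Prop :=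
  ∀ (xs : Fin n → ℕ) (o m : ℕ), (∀ i, xs i < m) → o < m → (∀ i, xs i ≠ o) →
    ∃ c, ∀ s : Regs, (∀ r, m ≤ r → s r = 0) →
      Exec c s (update s o (f (List.Vector.ofFn fun i => s (xs i))))

theorem Implementable.comp_range {m n : ℕ} {g : Fin n → List.Vector ℕ m → ℕ}
    (hg : ∀ i, Implementable (g i)) (xs : Fin m → ℕ) (b : ℕ) (hxs : ∀ i, xs i < b)
    (k : ℕ) (hk : k ≤ n) :
    ∃ c, ∀ s : Regs, (∀ r, b ≤ r → s r = 0) → Exec c s (fun r =>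
      if h : b ≤ r ∧ r < b + k then
        g ⟨r - b, by omega⟩ (List.Vector.ofFn fun i => s (xs i)) else s r) := by
  induction k with
  | zero =>
    exact ⟨.skip, fun s _ => (Exec.skip s).cast (by funext r; rw [dif_neg (by omega)])⟩
  | succ k ih =>
    obtain ⟨c, hc⟩ := ih (by omega)
    obtain ⟨d, hd⟩ := hg ⟨k, by omega⟩ xs (b + k) (b + n) (fun i => by have := hxs i; omega)
      (by omega) (fun i => by have := hxs i; omega)
    refine ⟨.seq c d, fun s hs => .seq (hc s hs) ((hd _ ?_).cast ?_)⟩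
    · intro r hr
      rw [dif_neg (by omega)]
      exact hs r (by omega)
    · funext r
      have hx : ∀ i, ¬ (b ≤ xs i ∧ xs i < b + k) := fun i => by have := hxs i; omega
      simp only [update_apply, hx, dite_false]
      by_cases h : r = b + k
      · subst h
        rw [if_pos rfl, dif_pos (by omega)]
        simp
      · rw [if_neg h]
        by_cases h' : b ≤ r ∧ r < b + k
        · rw [dif_pos h', dif_pos (by omega)]
        · rw [dif_neg h', dif_neg (by omega)]

theorem Implementable.comp {m n : ℕ} {f : List.Vector ℕ n → ℕ} {g : Fin n → List.Vector ℕ m → ℕ}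
    (hf : Implementable f) (hg : ∀ i, Implementable (g i)) :
    Implementable fun a => f (List.Vector.ofFn fun i => g i a) := by
  intro xs o b hxs ho hxo
  obtain ⟨c, hc⟩ := Implementable.comp_range hg xs b hxs n le_rfl
  obtain ⟨d, hd⟩ := hf (fun i => b + i) o (b + n) (fun i => by have := i.2; omega) (by omega)
    (fun i => by omega)
  obtain ⟨e, he⟩ := exists_clear_range b n
  refine ⟨.seq c (.seq d e), fun s hs => .seq (hc s hs) (.seq (hd _ ?_) ((he _).cast ?_))⟩
  · intro r hr
    rw [dif_neg (by omega)]
    exact hs r (by omega)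
  · funext r
    simp only [update_apply]
    by_cases h : b ≤ r ∧ r < b + n
    · rw [if_pos h, if_neg (by omega), hs r h.1]
    · rw [if_neg h]
      by_cases h' : r = o
      · simp [h']
      · simp [h', h]

theorem Implementable.prec {n : ℕ} {f : List.Vector ℕ n → ℕ} {g : List.Vector ℕ (n + 2) → ℕ}
    (hf : Implementable f) (hg : Implementable g) :
    Implementable fun v : List.Vector ℕ (n + 1) =>
      v.head.rec (f v.tail) fun y IH => g (y ::ᵥ IH ::ᵥ v.tail) := by
  intro xs o m hxs ho hxo
  obtain ⟨c, hc⟩ := hf (fun i => xs i.succ) o m (fun i => hxs _) ho (fun i => hxo _)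
  obtain ⟨d, hd⟩ := hg (Fin.cons (m + 1) (Fin.cons o fun i => xs i.succ)) (m + 2) (m + 3)
    (fun i => by
      refine Fin.cases ?_ (fun i => Fin.cases ?_ (fun i => ?_) i) i
      · simp
      · simp; omega
      · have := hxs i.succ; simp; omega)
    (by omega)
    (fun i => by
      refine Fin.cases ?_ (fun i => Fin.cases ?_ (fun i => ?_) i) i
      · simp
      · simp; omega
      · have := hxs i.succ; simp; omega)
  refine ⟨.seq c (.seq (copy (xs 0) m (m + 1)) (.seq (.loop m (.seq d (.seq
    (copy (m + 2) o (m + 3)) (.seq (clear (m + 2)) (.inc (m + 1)))))) (clear (m + 1)))),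
    fun s hs => ?_⟩
  have hx0 := hxs 0
  set v := List.Vector.ofFn fun i => s (xs i) with hv
  have htail : v.tail = List.Vector.ofFn fun i => s (xs i.succ) := by
    rw [hv]; simp [List.Vector.ofFn]
  have hhead : v.head = s (xs 0) := by rw [hv]; simp [List.Vector.ofFn]
  let F : ℕ → ℕ := fun k => Nat.rec (f v.tail) (fun y IH => g (y ::ᵥ IH ::ᵥ v.tail)) k
  refine .seq ((hc s hs).cast (s₂ := update s o (F 0)) (by simp [F, htail])) ?_
  refine .seq (exec_copy (by omega) (by omega) (by omega) _
    (by rw [update_apply, if_neg (by omega)]; exact hs _ (by omega))) ?_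
  have hloop := Exec.loop_of_family (r := m) (c := .seq d (.seq
    (copy (m + 2) o (m + 3)) (.seq (clear (m + 2)) (.inc (m + 1))))) (s (xs 0))
    (fun k => update (update (update s (m + 1) k) o (F k)) m (s (xs 0) - k)) (by simp)
    (fun k _ => by
      refine .seq (hd _ ?_) (.seq (exec_copy (by omega) (by omega) (by omega) _ ?_)
        (.seq (exec_clear _ _) ((Exec.inc _ _).cast ?_)))
      · intro r hr
        simp only [update_apply]
        rw [if_neg (by omega), if_neg (by omega), if_neg (by omega), if_neg (by omega)]
        exact hs r (by omega)
      · simp only [update_apply]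
        rw [if_neg (by omega), if_neg (by omega), if_neg (by omega), if_neg (by omega),
          if_neg (by omega)]
        exact hs _ (by omega)
      · have hin : (List.Vector.ofFn fun i => (update (update (update (update s (m + 1) k) o (F k))
            m (s (xs 0) - k)) m (s (xs 0) - k - 1))
            ((Fin.cons (m + 1) (Fin.cons o fun i => xs i.succ) : Fin (n + 2) → ℕ) i)) =
            k ::ᵥ F k ::ᵥ v.tail := by
          rw [htail]
          ext i
          refine Fin.cases ?_ (fun i => Fin.cases ?_ (fun i => ?_) i) i
          · simp [update_apply]; omega
          · simp only [List.Vector.get_ofFn, Fin.cons_succ, Fin.cons_zero,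
              List.Vector.get_cons_succ, List.Vector.get_cons_zero, update_apply]
            rw [if_neg (by omega), if_neg (by omega), if_pos trivial]
          · have h1 := hxs i.succ
            have h2 := hxo i.succ
            simp only [List.Vector.get_ofFn, Fin.cons_succ, List.Vector.get_cons_succ,
              update_apply]
            rw [if_neg (by omega), if_neg (by omega), if_neg (by omega), if_neg (by omega)]
        rw [hin]
        funext r
        have hs2 := hs (m + 2) (by omega)
        have hF : F (k + 1) = g (k ::ᵥ F k ::ᵥ v.tail) := rfl
        rw [hF]
        simp only [update_apply]
        split_ifs <;> first | omega | simp_all)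
  refine .seq (s₂ := update (update s (m + 1) (s (xs 0))) o (F (s (xs 0)))) ?_
    ((exec_clear _ _).cast ?_)
  · refine hloop.cast_both ?_ ?_
    · funext r
      have h1 := hs (m + 1) (by omega)
      have h2 := hxo 0
      simp only [update_apply]
      split_ifs <;> first | omega | simp_all
    · funext r
      have h1 := hs m (by omega)
      simp only [update_apply]
      split_ifs <;> first | omega | simp_all
  · funext r
    have h1 := hs (m + 1) (by omega)
    have hF : F (s (xs 0)) = Nat.rec (f v.tail) (fun y IH => g (y ::ᵥ IH ::ᵥ v.tail)) v.head := by
      rw [hhead]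
    show _ = update s o (Nat.rec (f v.tail) (fun y IH => g (y ::ᵥ IH ::ᵥ v.tail)) v.head) r
    rw [← hF]
    simp only [update_apply]
    split_ifs <;> first | omega | simp_all

theorem implementable_of_primrec {n : ℕ} {f : List.Vector ℕ n → ℕ} (hf : Nat.Primrec' f) :
    Implementable f := by
  induction hf with
  | zero => exact fun xs o m _ _ _ => ⟨clear o, fun s _ => exec_clear o s⟩
  | succ =>
    intro xs o m hxs ho hxo
    refine ⟨.seq (copy (xs 0) o m) (.inc o), fun s hs => .seq
      (exec_copy (hxo 0) (hxs 0).ne ho.ne s (hs m le_rfl)) ((Exec.inc _ _).cast ?_)⟩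
    simp [List.Vector.ofFn]
  | get i =>
    intro xs o m hxs ho hxo
    refine ⟨copy (xs i) o m, fun s hs =>
      (exec_copy (hxo i) (hxs i).ne ho.ne s (hs m le_rfl)).cast (by simp)⟩
  | comp g _ _ hf hg => exact hf.comp hg
  | prec _ _ hf hg => exact hf.prec hg

end CounterProgram
/-! ### Counter machines -/

namespace CounterProgram

open Function Relation

/-- Instructions of a counter machine: increment and go to `q`; decrement and go to `q`, or go to
`q'` if the register is zero; go to `q`. -/
inductive Instr where
  | inc (r q : ℕ)
  | dec (r q q' : ℕ)
  | jump (q : ℕ)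

/-- The steps of a counter machine on pairs of a program counter and register contents. -/
inductive MStep (p : List Instr) : ℕ × Regs → ℕ × Regs → Prop where
  | inc {i r q : ℕ} {s : Regs} : p[i]? = some (.inc r q) →
      MStep p (i, s) (q, update s r (s r + 1))
  | decSucc {i r q q' : ℕ} {s : Regs} : p[i]? = some (.dec r q q') → s r ≠ 0 →
      MStep p (i, s) (q, update s r (s r - 1))
  | decZero {i r q q' : ℕ} {s : Regs} : p[i]? = some (.dec r q q') → s r = 0 →
      MStep p (i, s) (q', s)
  | jump {i q : ℕ} {s : Regs} : p[i]? = some (.jump q) → MStep p (i, s) (q, s)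

theorem MStep.unique {p : List Instr} {a b c : ℕ × Regs} (h : MStep p a b) (h' : MStep p a c) :
    b = c := by
  cases h <;> cases h' <;> simp_all

/-- In a deterministic system, a configuration from which a terminal one is reached is not in a set
all of whose members can be continued within the set. -/
theorem not_reaches_of_invariant {α : Type} {R : α → α → Prop}
    (hR : ∀ a b c, R a b → R a c → b = c) (I : Set α)
    (hI : ∀ a ∈ I, ∃ b ∈ I, TransGen R a b) {a t : α} (ha : a ∈ I) (h : ReflTransGen R a t)
    (ht : ∀ b, ¬ R t b) : False := by
  have acc : Acc (Function.swap R) a := by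
    clear ha
    induction h using ReflTransGen.head_induction_on with
    | refl => exact ⟨_, fun b hb => (ht b hb).elim⟩
    | head hab _ ih => exact ⟨_, fun b hb => hR _ _ _ hab hb ▸ ih⟩
  clear h
  induction acc.transGen with
  | intro a _ ih =>
    obtain ⟨b, hb, hab⟩ := hI a ha
    have hba := transGen_swap.2 hab
    exact ih b hba hb (acc.inv_of_transGen hba)

/-- The machine code of a program, placed at the address `a` and continuing at the address `b`. -/
def compile : Cmd → ℕ → ℕ → List Instr
  | .skip, _, b => [.jump b]
  | .inc r, _, b => [.inc r b]
  | .seq c d, a, b =>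
    compile c a (a + (compile c 0 0).length) ++ compile d (a + (compile c 0 0).length) b
  | .loop r c, a, b => .dec r (a + 1) b :: compile c (a + 1) a

theorem length_compile (c : Cmd) (a b : ℕ) : (compile c a b).length = (compile c 0 0).length := by
  induction c generalizing a b with
  | skip => rfl
  | inc r => rfl
  | seq c d hc hd =>
    simp only [compile, List.length_append]
    rw [hc, hd, hc 0 (0 + _), hd (0 + _)]
  | loop r c hc =>
    simp only [compile, List.length_cons]
    rw [hc, hc (0 + 1)]

/-- The list `l` of instructions occurs in `p` at the address `a`. -/
def CodeAt (p : List Instr) (a : ℕ) (l : List Instr) : Prop :=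
  ∀ k ins, l[k]? = some ins → p[a + k]? = some ins

theorem CodeAt.left {p l l' : List Instr} {a : ℕ} (h : CodeAt p a (l ++ l')) : CodeAt p a l :=
  fun k ins hk => h k ins (by
    rw [List.getElem?_append_left (List.getElem?_eq_some_iff.1 hk).1]; exact hk)

theorem CodeAt.right {p l l' : List Instr} {a : ℕ} (h : CodeAt p a (l ++ l')) :
    CodeAt p (a + l.length) l' := fun k ins hk => by
  have := h (l.length + k) ins (by rw [List.getElem?_append_right (by omega)]; simpa using hk)
  rwa [← Nat.add_assoc] at this

theorem CodeAt.head {p l : List Instr} {ins : Instr} {a : ℕ} (h : CodeAt p a (ins :: l)) :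
    p[a]? = some ins := h 0 ins rfl

theorem CodeAt.tail {p l : List Instr} {ins : Instr} {a : ℕ} (h : CodeAt p a (ins :: l)) :
    CodeAt p (a + 1) l := CodeAt.right (l := [ins]) h

theorem Exec.transGen {c : Cmd} {s s' : Regs} (h : Exec c s s') {p : List Instr} {a b : ℕ}
    (hp : CodeAt p a (compile c a b)) : TransGen (MStep p) (a, s) (b, s') := by
  induction h generalizing a b with
  | skip s => exact .single (.jump hp.head)
  | inc r s => exact .single (.inc hp.head)
  | seq _ _ ih₁ ih₂ =>
    have h := hp.right
    rw [length_compile] at h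
    exact (ih₁ hp.left).trans (ih₂ h)
  | loopZero h => exact .single (.decZero hp.head h)
  | loopSucc h _ _ ih₁ ih₂ => exact .head (.decSucc hp.head h) ((ih₁ hp.tail).trans (ih₂ hp))

/-- The registers of a machine started with the input `n`. -/
def input (n : ℕ) : Regs := fun r => if r = 0 then n else 0

/-- Every primitive recursive predicate `g` has a counter machine that, started with `n` in
register `0`, halts iff `g n k = 0` for some `k`. -/
theorem exists_machine {g : ℕ → ℕ → ℕ} (hg : Primrec₂ g) :
    ∃ p : List Instr, ∀ n, (∃ s, ReflTransGen (MStep p) (0, input n) (p.length, s)) ↔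
      ∃ k, g n k = 0 := by
  obtain ⟨c, hc⟩ := implementable_of_primrec (Nat.Primrec'.prim_iff₂.2 hg) (fun i => i) 2 3
    (by omega) (by omega) (by omega)
  replace hc : ∀ s : Regs, (∀ r, 3 ≤ r → s r = 0) → Exec c s (update s 2 (g (s 0) (s 1))) := by
    intro s hs
    exact (hc s hs).cast (by simp [List.Vector.ofFn])
  let body : Cmd := .seq c (.inc 1)
  let main : Cmd := .seq (.inc 2) (.loop 2 body)
  have hbody : ∀ s : Regs, (∀ r, 3 ≤ r → s r = 0) →
      Exec body s (update (update s 2 (g (s 0) (s 1))) 1 (s 1 + 1)) := fun s hs =>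
    .seq (hc s hs) ((Exec.inc _ _).cast (by simp))
  have hloop : ∀ d (s : Regs), s 2 ≠ 0 → (∀ r, 3 ≤ r → s r = 0) → g (s 0) (s 1 + d) = 0 →
      ∃ s', Exec (.loop 2 body) s s' := by
    intro d
    induction d with
    | zero =>
      intro s h2 hs h0
      refine ⟨_, .loopSucc h2 (hbody _ fun r hr => ?_) (.loopZero ?_)⟩
      · rw [update_apply, if_neg (by omega)]; exact hs r hr
      · simpa using h0
    | succ d ih =>
      intro s h2 hs h0
      have hb := hbody (update s 2 (s 2 - 1)) fun r hr => by
        rw [update_apply, if_neg (by omega)]; exact hs r hr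
      by_cases hz : g (s 0) (s 1) = 0
      · exact ⟨_, .loopSucc h2 hb (.loopZero (by simpa using hz))⟩
      · obtain ⟨s', h'⟩ := ih (update (update (update s 2 (s 2 - 1)) 2 (g (s 0) (s 1))) 1
            (s 1 + 1)) (by simpa using hz) (fun r hr => by
          simp only [update_apply]
          rw [if_neg (by omega), if_neg (by omega), if_neg (by omega)]; exact hs r hr)
          (by simpa [Nat.add_assoc, Nat.add_comm 1] using h0)
        exact ⟨s', .loopSucc h2 (hb.cast (by simp)) h'⟩
  let L := (compile main 0 0).length
  let p := compile main 0 L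
  have hL : p.length = L := length_compile _ _ _
  have hat : CodeAt p 0 (compile main 0 L) := fun k ins hk => by rw [Nat.zero_add]; exact hk
  refine ⟨p, fun n => ⟨fun ⟨s, hs⟩ => ?_, fun ⟨k, hk⟩ => ?_⟩⟩
  · by_contra! hne
    let I : Set (ℕ × Regs) := {x | x = (0, input n) ∨
      x.1 = 1 ∧ x.2 0 = n ∧ x.2 2 ≠ 0 ∧ ∀ r, 3 ≤ r → x.2 r = 0}
    refine not_reaches_of_invariant (R := MStep p) (fun _ _ _ => MStep.unique) I ?_
      (Or.inl rfl) hs ?_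
    · rintro ⟨i, s⟩ (h | ⟨h1, h0, h2, h3⟩)
      · rw [h]
        refine ⟨_, .inr ?_, (Exec.inc 2 _).transGen hat.left⟩
        refine ⟨rfl, by simp [input], by simp, fun r hr => ?_⟩
        dsimp only
        rw [update_apply, if_neg (by omega), input, if_neg (by omega)]
      · dsimp only at h1 h0 h2 h3
        subst h1
        have hright : CodeAt p 1 (compile (.loop 2 body) 1 L) := hat.right
        refine ⟨_, .inr ?_, .head (.decSucc hright.head h2)
          ((hbody _ fun r hr => ?_).transGen hright.tail)⟩
        · refine ⟨rfl, by simpa using h0, by simpa [h0] using hne (s 1), fun r hr => ?_⟩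
          simp only [update_apply]
          rw [if_neg (by omega), if_neg (by omega), if_neg (by omega)]; exact h3 r hr
        · rw [update_apply, if_neg (by omega)]; exact h3 r hr
    · intro b hb
      have : ∀ ins, p[p.length]? ≠ some ins := by simp
      cases hb <;> exact this _ ‹_›
  · obtain ⟨s', h'⟩ := hloop k (update (input n) 2 1) (by simp)
      (fun r hr => by rw [update_apply, if_neg (by omega), input, if_neg (by omega)])
      (by simpa [input] using hk)
    have hm : Exec main (input n) s' := .seq ((Exec.inc 2 _).cast (by simp [input])) h'
    exact ⟨s', hL ▸ (hm.transGen hat).to_reflTransGen⟩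

end CounterProgram
/-! ### Contracts that simulate counter machines -/

namespace MuStipula

open Function Relation CounterProgram

/-- The states of the simulating contracts. -/
inductive SimState where
  /-- the initial state -/
  | init
  /-- the state that is reachable iff the machine halts -/
  | halt
  /-- the program counter is `i` -/
  | pc (i : ℕ)
  /-- a token of the register `r` is being consumed -/
  | dec (r : ℕ)
  /-- a token of the register `r` has been consumed -/
  | ack (r : ℕ)
  /-- the register `r` was found to be zero -/
  | zero (r : ℕ)

/-- The name of a state. -/
def SimState.code : SimState → ℕ
  | .init => 0
  | .halt => 1
  | .pc i => 4 * i + 4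
  | .dec r => 4 * r + 5
  | .ack r => 4 * r + 6
  | .zero r => 4 * r + 7

theorem SimState.code_injective : Function.Injective SimState.code := by
  intro a b h
  cases a <;> cases b <;> simp only [SimState.code] at h <;>
    first | rfl | (exfalso; omega) | (congr 1; omega)

@[simp]
theorem SimState.code_inj {a b : SimState} : a.code = b.code ↔ a = b :=
  SimState.code_injective.eq_iff

/-- The event definition that, when pending, is a token of the register `r`. -/
def tokenDef (r : ℕ) : EventDef := ⟨0, (SimState.dec r).code, (SimState.ack r).code⟩

/-- The functions for the instruction `ins` at the address `i`. -/
def instrFuns (i : ℕ) : Instr → List FunDef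
  | .inc r q => [⟨(SimState.pc i).code, 0, [tokenDef r], (SimState.pc q).code⟩]
  | .dec r q q' => [⟨(SimState.pc i).code, 0, [⟨0, (SimState.ack r).code, (SimState.pc q).code⟩],
        (SimState.dec r).code⟩,
      ⟨(SimState.pc i).code, 1, [⟨0, (SimState.zero r).code, (SimState.pc q').code⟩],
        (SimState.dec r).code⟩,
      ⟨(SimState.dec r).code, 0, [], (SimState.zero r).code⟩]
  | .jump q => [⟨(SimState.pc i).code, 0, [], (SimState.pc q).code⟩]

/-- The function that can be called in the state `SimState.halt`. -/
def haltFun : FunDef := ⟨SimState.halt.code, 0, [], SimState.halt.code⟩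

/-- All functions for the machine `p`, with repetitions. -/
def machineFunsAux (p : List Instr) : List FunDef :=
  haltFun :: p.zipIdx.flatMap fun x => instrFuns x.2 x.1

open Classical in
/-- The functions for the machine `p`. -/
noncomputable def machineFuns (p : List Instr) : List FunDef := (machineFunsAux p).dedup

/-- The function that starts the simulation of the machine `p` on the input `n`. The first event
guards the state `SimState.halt`: it is lost with the first tick. -/
def initFun (p : List Instr) (n : ℕ) : FunDef :=
  ⟨SimState.init.code, 0, ⟨0, (SimState.pc p.length).code, SimState.halt.code⟩ ::
    List.replicate n (tokenDef 0), (SimState.pc 0).code⟩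

/-- The contract that simulates the machine `p` on the input `n`. -/
noncomputable def machineContract (p : List Instr) (n : ℕ) : Contract :=
  ⟨SimState.init.code, initFun p n :: machineFuns p⟩

theorem mem_machineFuns {p : List Instr} {F : FunDef} : F ∈ machineFuns p ↔
    F = haltFun ∨ ∃ i ins, p[i]? = some ins ∧ F ∈ instrFuns i ins := by
  simp only [machineFuns, machineFunsAux, List.mem_dedup, List.mem_cons, List.mem_flatMap,
    Prod.exists, List.mem_zipIdx_iff_getElem?]
  constructor
  · rintro (h | ⟨a, b, h, h'⟩)
    exacts [.inl h, .inr ⟨b, a, h, h'⟩]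
  · rintro (h | ⟨a, b, h, h'⟩)
    exacts [.inl h, .inr ⟨b, a, h, h'⟩]

/-- The functions for a machine, case by case. -/
inductive IsMachineFun (p : List Instr) : FunDef → Prop where
  | halt : IsMachineFun p ⟨SimState.halt.code, 0, [], SimState.halt.code⟩
  | inc {i r q : ℕ} : p[i]? = some (.inc r q) →
      IsMachineFun p ⟨(SimState.pc i).code, 0, [tokenDef r], (SimState.pc q).code⟩
  | decSucc {i r q q' : ℕ} : p[i]? = some (.dec r q q') →
      IsMachineFun p ⟨(SimState.pc i).code, 0, [⟨0, (SimState.ack r).code, (SimState.pc q).code⟩],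
        (SimState.dec r).code⟩
  | decZero {i r q q' : ℕ} : p[i]? = some (.dec r q q') →
      IsMachineFun p ⟨(SimState.pc i).code, 1, [⟨0, (SimState.zero r).code, (SimState.pc q').code⟩],
        (SimState.dec r).code⟩
  | test {i r q q' : ℕ} : p[i]? = some (.dec r q q') →
      IsMachineFun p ⟨(SimState.dec r).code, 0, [], (SimState.zero r).code⟩
  | jump {i q : ℕ} : p[i]? = some (.jump q) →
      IsMachineFun p ⟨(SimState.pc i).code, 0, [], (SimState.pc q).code⟩

theorem mem_machineFuns_iff {p : List Instr} {F : FunDef} :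
    F ∈ machineFuns p ↔ IsMachineFun p F := by
  rw [mem_machineFuns]
  constructor
  · rintro (rfl | ⟨i, ins, h, hF⟩)
    · exact .halt
    · cases ins <;> simp only [instrFuns, List.mem_cons, List.not_mem_nil, or_false] at hF
      · exact hF ▸ .inc h
      · rcases hF with rfl | rfl | rfl
        exacts [.decSucc h, .decZero h, .test h]
      · exact hF ▸ .jump h
  · rintro (_ | h | h | h | h | h)
    · exact .inl rfl
    all_goals exact .inr ⟨_, _, h, by simp [instrFuns]⟩

theorem machineContract_mem (p : List Instr) (n : ℕ) :
    machineContract p n ∈ InstantaneousContracts := by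
  constructor
  · have hinj : ∀ F ∈ machineFuns p, ∀ G ∈ machineFuns p,
        Clause.func F.src F.name F.tgt = Clause.func G.src G.name G.tgt → F = G := by
      intro F hF G hG h
      rw [mem_machineFuns_iff] at hF hG
      injection h with h₁ h₂ h₃
      cases hF <;> cases hG <;>
        first
        | rfl
        | simp at h₁ h₂ h₃; done
        | simp at h₁ h₂ h₃; subst_vars; simp_all
    simp only [Contract.WellFormed, Contract.funClauses, machineContract, List.map_cons,
      List.nodup_cons]
    refine ⟨?_, List.Nodup.map_on hinj (by classical exact List.nodup_dedup _)⟩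
    simp only [List.mem_map, not_exists, not_and, mem_machineFuns_iff]
    intro F hF h
    injection h with h₁ h₂ h₃
    cases hF <;> simp [initFun] at h₁
  · intro F hF e he
    rcases List.mem_cons.1 hF with rfl | hF
    · rcases List.mem_cons.1 he with rfl | he
      · rfl
      · rw [List.eq_of_mem_replicate he]; rfl
    · rw [mem_machineFuns_iff] at hF
      cases hF <;> simp only [List.mem_cons, List.not_mem_nil, or_false] at he <;> subst he <;> rfl

/-- The pending event that guards the state `SimState.halt`. -/
def guardEvent (p : List Instr) : Pending :=
  ⟨0, 0, (SimState.pc p.length).code, SimState.halt.code⟩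

/-- The pending events `Ψ` represent the registers `s`, and contain the guard. -/
structure Represents (p : List Instr) (s : Regs) (Ψ : Multiset Pending) : Prop where
  time : ∀ e ∈ Ψ, e.time = 0
  shape : ∀ e ∈ Ψ, e = guardEvent p ∨
    ∃ r, e.src = (SimState.dec r).code ∧ e.tgt = (SimState.ack r).code
  count : ∀ r, Ψ.countP (fun e => e.src = (SimState.dec r).code) = s r
  guard : guardEvent p ∈ Ψ

section Represents

variable {p : List Instr} {s : Regs} {Ψ : Multiset Pending}

theorem Represents.src (h : Represents p s Ψ) {e : Pending} (he : e ∈ Ψ) :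
    e.src = (SimState.pc p.length).code ∨ ∃ r, e.src = (SimState.dec r).code := by
  rcases h.shape e he with rfl | ⟨r, hr, _⟩
  exacts [.inl rfl, .inr ⟨r, hr⟩]

theorem Represents.cons_token (h : Represents p s Ψ) (l r : ℕ) :
    Represents p (update s r (s r + 1))
      (⟨0, l, (SimState.dec r).code, (SimState.ack r).code⟩ ::ₘ Ψ) where
  time e he := by
    rcases Multiset.mem_cons.1 he with rfl | he
    exacts [rfl, h.time e he]
  shape e he := by
    rcases Multiset.mem_cons.1 he with rfl | he
    exacts [.inr ⟨r, rfl, rfl⟩, h.shape e he]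
  count r' := by
    rw [Multiset.countP_cons, h.count, update_apply]
    by_cases hr : r' = r
    · simp [hr]
    · rw [if_neg hr, if_neg (by simpa using Ne.symm hr), Nat.add_zero]
  guard := Multiset.mem_cons_of_mem h.guard

theorem Represents.of_cons {l r : ℕ} {Q : StateName}
    (h : Represents p s (⟨0, l, (SimState.dec r).code, Q⟩ ::ₘ Ψ)) :
    Q = (SimState.ack r).code ∧ s r ≠ 0 ∧ Represents p (update s r (s r - 1)) Ψ := by
  have hne : guardEvent p ≠ ⟨0, l, (SimState.dec r).code, Q⟩ := by
    simp [guardEvent]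
  have hcount := h.count
  simp only [Multiset.countP_cons, SimState.code_inj, SimState.dec.injEq] at hcount
  refine ⟨?_, ?_, fun e he => h.time e (Multiset.mem_cons_of_mem he),
    fun e he => h.shape e (Multiset.mem_cons_of_mem he), fun r' => ?_, ?_⟩
  · rcases h.shape _ (Multiset.mem_cons_self _ _) with h' | ⟨r', h₁, h₂⟩
    · exact absurd h'.symm hne
    · simp only [SimState.code_inj, SimState.dec.injEq] at h₁ h₂
      rw [h₂, h₁]
  · have := hcount r
    simp only [if_true] at this
    omega
  · have := hcount r'
    rw [update_apply]
    by_cases hr : r' = r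
    · subst hr
      simp only [if_true] at this ⊢
      omega
    · rw [if_neg (Ne.symm hr)] at this
      rw [if_neg hr]
      omega
  · exact (Multiset.mem_cons.1 h.guard).resolve_left hne

theorem Represents.exists_token (h : Represents p s Ψ) {r : ℕ} (hr : s r ≠ 0) :
    ∃ l Ψ', Ψ = ⟨0, l, (SimState.dec r).code, (SimState.ack r).code⟩ ::ₘ Ψ' := by
  rw [← h.count r] at hr
  obtain ⟨e, he, hsrc⟩ := Multiset.countP_pos.1 (Nat.pos_of_ne_zero hr)
  obtain ⟨Ψ', rfl⟩ := Multiset.exists_cons_of_mem he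
  obtain ⟨t, l, Q, Q'⟩ := e
  have ht := h.time _ he
  dsimp only at ht hsrc
  subst ht hsrc
  obtain ⟨rfl, -⟩ := h.of_cons
  exact ⟨l, Ψ', rfl⟩

theorem Represents.noRed (h : Represents p s Ψ) {Q : StateName}
    (h₁ : Q ≠ (SimState.pc p.length).code)
    (h₂ : ∀ r, Q ≠ (SimState.dec r).code) : NoRed Ψ Q := by
  intro e he
  right
  rcases h.src he with h' | ⟨r, h'⟩ <;> rw [h']
  exacts [h₁.symm, (h₂ r).symm]

theorem Represents.noRed_dec (h : Represents p s Ψ) {r : ℕ} :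
    NoRed Ψ (SimState.dec r).code ↔ s r = 0 := by
  rw [← h.count, Multiset.countP_eq_zero]
  exact ⟨fun h' e he => (h' e he).resolve_left (by simpa using h.time e he),
    fun h' e he => .inr (h' e he)⟩

end Represents

theorem NoRed.cons {Ψ : Multiset Pending} {Q : StateName} (h : NoRed Ψ Q) {e : Pending}
    (he : e.src ≠ Q) : NoRed (e ::ₘ Ψ) Q := fun e' he' => by
  rcases Multiset.mem_cons.1 he' with rfl | he'
  exacts [.inr he, h e' he']

theorem represents_linecode (p : List Instr) (n : ℕ) :
    Represents p (input n) ((machineContract p n).linecode 0 (initFun p n).body) := by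
  have hmem : ∀ e ∈ (machineContract p n).linecode 0 (initFun p n).body,
      e = guardEvent p ∨ e.time = 0 ∧ e.src = (SimState.dec 0).code ∧
        e.tgt = (SimState.ack 0).code := by
    intro e he
    simp only [Contract.linecode, initFun, Multiset.mem_coe, List.mem_map, List.zipIdx_cons,
      List.mem_cons, exists_eq_or_imp, Prod.exists] at he
    rcases he with rfl | ⟨a, b, hab, rfl⟩
    · exact .inl (by simp [guardEvent, Contract.offset])
    · obtain rfl : a = tokenDef 0 :=
        List.eq_of_mem_replicate (List.fst_mem_of_mem_zipIdx hab)
      exact .inr ⟨rfl, rfl, rfl⟩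
  refine ⟨fun e he => ?_, fun e he => ?_, fun r => ?_, ?_⟩
  · rcases hmem e he with rfl | h
    exacts [rfl, h.1]
  · rcases hmem e he with h | h
    exacts [.inl h, .inr ⟨0, h.2⟩]
  · have hg : (SimState.pc p.length).code ≠ (SimState.dec r).code := by simp
    rw [Contract.linecode, Multiset.coe_countP, List.countP_map]
    have : ((fun e : Pending => decide (e.src = (SimState.dec r).code)) ∘
        fun q : EventDef × ℕ => Pending.mk q.1.delay q.2 q.1.src q.1.tgt) =
        (fun e : EventDef => decide (e.src = (SimState.dec r).code)) ∘ Prod.fst := rfl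
    rw [this, ← List.countP_map, List.zipIdx_map_fst]
    simp only [initFun, List.countP_cons, List.countP_replicate, tokenDef,
      SimState.code_inj, SimState.dec.injEq, hg, input]
    by_cases hr : r = 0
    · simp [hr]
    · simp [hr, Ne.symm hr]
  · simp [Contract.linecode, initFun, guardEvent, Contract.offset]

end MuStipula
/-! ### Correctness of the simulation -/

namespace MuStipula

open Function Relation CounterProgram

theorem Contract.linecode_nil (C : Contract) (i : ℕ) : C.linecode i [] = 0 := rfl

theorem Contract.linecode_singleton (C : Contract) (i : ℕ) (e : EventDef) :
    C.linecode i [e] = {⟨e.delay, C.offset i, e.src, e.tgt⟩} := rfl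

theorem mem_down {Ψ : Multiset Pending} {e : Pending} (h : e ∈ down Ψ) :
    ∃ e' ∈ Ψ, e'.time = e.time + 1 ∧ e'.tgt = e.tgt := by
  obtain ⟨e', he', h⟩ := (Multiset.mem_filterMap _ _).1 h
  obtain ⟨_ | t, l, Q, Q'⟩ := e'
  · simp [Pending.down] at h
  · simp only [Pending.down, Option.some.injEq] at h
    subst h
    exact ⟨_, he', rfl, rfl⟩

theorem down_eq_zero {Ψ : Multiset Pending} (h : ∀ e ∈ Ψ, e.time = 0) : down Ψ = 0 := by
  refine Multiset.eq_zero_of_forall_notMem fun e he => ?_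
  obtain ⟨e', he', h', -⟩ := mem_down he
  rw [h e' he'] at h'
  omega

/-- The machine `p`, started with the input `n`, reaches the program counter `i` with the register
contents `s`. -/
def MReach (p : List Instr) (n i : ℕ) (s : Regs) : Prop :=
  ReflTransGen (MStep p) (0, input n) (i, s)

/-- States and pending events of the simulating contract, if the machine does not halt: they
represent an intermediate stage of the simulation of a step of the machine, or the contract is stuck
after a wrong guess on the next step, or the guard has been lost. -/
inductive Good (p : List Instr) (n : ℕ) : StateName → Multiset Pending → Prop where
  | init : Good p n SimState.init.code 0
  | run {i : ℕ} {s : Regs} {Ψ : Multiset Pending} (hs : MReach p n i s)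
      (hΨ : Represents p s Ψ) : Good p n (SimState.pc i).code Ψ
  | testSucc {l r q : ℕ} {s : Regs} {Ψ : Multiset Pending}
      (hs : s r ≠ 0 → MReach p n q (update s r (s r - 1))) (hΨ : Represents p s Ψ) :
      Good p n (SimState.dec r).code (⟨0, l, (SimState.ack r).code, (SimState.pc q).code⟩ ::ₘ Ψ)
  | testZero {l r q : ℕ} {s : Regs} {Ψ : Multiset Pending}
      (hs : s r = 0 → MReach p n q s) (hΨ : Represents p s Ψ) :
      Good p n (SimState.dec r).code (⟨0, l, (SimState.zero r).code, (SimState.pc q).code⟩ ::ₘ Ψ)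
  | resume {x : SimState} {l r q : ℕ} {s : Regs} {Ψ : Multiset Pending}
      (hx : x = .ack r ∨ x = .zero r) (hs : MReach p n q s) (hΨ : Represents p s Ψ) :
      Good p n x.code (⟨0, l, x.code, (SimState.pc q).code⟩ ::ₘ Ψ)
  | stuck {x : SimState} {r : ℕ} {Ψ : Multiset Pending}
      (hx : x = .ack r ∨ x = .zero r) (ht : ∀ e ∈ Ψ, e.time = 0) (hΨ : NoRed Ψ x.code) :
      Good p n x.code Ψ
  | lost {Q : StateName} {Ψ : Multiset Pending} (hi : Q ≠ SimState.init.code)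
      (hh : Q ≠ SimState.halt.code)
      (hΨ : ∀ e ∈ Ψ, e.tgt ≠ SimState.init.code ∧ e.tgt ≠ SimState.halt.code) : Good p n Q Ψ

section Good

variable {p : List Instr} {n : ℕ}

theorem Good.ne_halt {Q : StateName} {Ψ : Multiset Pending} (h : Good p n Q Ψ) :
    Q ≠ SimState.halt.code := by
  cases h with
  | resume hx => rcases hx with rfl | rfl <;> simp
  | stuck hx => rcases hx with rfl | rfl <;> simp
  | lost _ hh => exact hh
  | _ => simp

theorem Good.function_init {i : ℕ} {Ψ : Multiset Pending} (h : Good p n SimState.init.code Ψ) :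
    i = 0 → Good p n (initFun p n).tgt
      ((machineContract p n).linecode i (initFun p n).body + Ψ) := by
  rintro rfl
  generalize hQ : SimState.init.code = Q at h
  cases h with
  | init => exact .run .refl (by rw [add_zero]; exact represents_linecode p n)
  | resume hx => rcases hx with rfl | rfl <;> simp at hQ
  | stuck hx => rcases hx with rfl | rfl <;> simp at hQ
  | lost hi => exact absurd hQ.symm hi
  | _ => simp at hQ

theorem Good.function {F : FunDef} (hF : IsMachineFun p F) {i : ℕ} {Ψ : Multiset Pending}
    (h : Good p n F.src Ψ) (hΨ : NoRed Ψ F.src) :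
    Good p n F.tgt ((machineContract p n).linecode i F.body + Ψ) := by
  generalize hQ : F.src = Q at h
  cases h with
  | init => cases hF <;> simp at hQ
  | run hs hR =>
    cases hF <;> simp only [SimState.code_inj, SimState.pc.injEq, reduceCtorEq] at hQ <;>
      subst hQ <;> simp only [Contract.linecode_nil, Contract.linecode_singleton,
        Multiset.singleton_add, zero_add]
    case inc h => exact .run (hs.tail (.inc h)) (hR.cons_token _ _)
    case decSucc h => exact .testSucc (fun h0 => hs.tail (.decSucc h h0)) hR
    case decZero h => exact .testZero (fun h0 => hs.tail (.decZero h h0)) hR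
    case jump h => exact .run (hs.tail (.jump h)) hR
  | testSucc hs hR =>
    cases hF <;> simp only [SimState.code_inj, SimState.dec.injEq, reduceCtorEq] at hQ
    subst hQ
    simp only [Contract.linecode_nil, zero_add]
    refine .stuck (.inr rfl) ?_ (NoRed.cons (hR.noRed (by simp) (by simp)) (by simp))
    simpa using hR.time
  | testZero hs hR =>
    cases hF <;> simp only [SimState.code_inj, SimState.dec.injEq, reduceCtorEq] at hQ
    subst hQ
    simp only [Contract.linecode_nil, zero_add]
    have h0 := hR.noRed_dec.1 fun e he => hΨ e (Multiset.mem_cons_of_mem he)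
    exact .resume (.inr rfl) (hs h0) hR
  | resume hx => rcases hx with rfl | rfl <;> cases hF <;> simp at hQ
  | stuck hx => rcases hx with rfl | rfl <;> cases hF <;> simp at hQ
  | lost hi hh hl =>
    subst hQ
    refine .lost ?_ ?_ ?_
    · cases hF <;> simp
    · cases hF <;> simp at hh ⊢
    · cases hF <;> simpa [Contract.linecode_nil, Contract.linecode_singleton, tokenDef] using hl

theorem Good.eventMatch (hn : ¬ ∃ s, MReach p n p.length s) {l : LineCode} {Q Q' : StateName}
    {Ψ : Multiset Pending} (h : Good p n Q (⟨0, l, Q, Q'⟩ ::ₘ Ψ)) : Good p n Q' Ψ := by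
  generalize hΨ : (⟨0, l, Q, Q'⟩ : Pending) ::ₘ Ψ = Ψ₀ at h
  cases h with
  | init => simp at hΨ
  | @run i s _ hs hR =>
    subst hΨ
    rcases hR.src (Multiset.mem_cons_self _ _) with h | ⟨r, h⟩ <;> simp at h
    exact absurd ⟨s, h ▸ hs⟩ hn
  | testSucc hs hR =>
    rcases Multiset.cons_eq_cons.1 hΨ with ⟨h, -⟩ | ⟨-, Ψ', rfl, rfl⟩
    · simp at h
    · obtain ⟨rfl, h0, hR'⟩ := hR.of_cons
      exact .resume (.inl rfl) (hs h0) hR'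
  | testZero hs hR =>
    rcases Multiset.cons_eq_cons.1 hΨ with ⟨h, -⟩ | ⟨-, Ψ', rfl, rfl⟩
    · simp at h
    · obtain ⟨rfl, h0, hR'⟩ := hR.of_cons
      refine .stuck (.inl rfl) ?_ (NoRed.cons (hR'.noRed (by simp) (by simp)) (by simp))
      simpa using hR'.time
  | resume hx hs hR =>
    rcases Multiset.cons_eq_cons.1 hΨ with ⟨h, rfl⟩ | ⟨-, Ψ', rfl, rfl⟩
    · simp only [Pending.mk.injEq] at h
      obtain ⟨-, -, -, rfl⟩ := h
      exact .run hs hR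
    · rcases hR.src (Multiset.mem_cons_self _ _) with h | ⟨r', h⟩ <;>
        rcases hx with rfl | rfl <;> simp at h
  | stuck hx ht hR =>
    subst hΨ
    simpa using hR _ (Multiset.mem_cons_self _ _)
  | lost hi hh hl =>
    subst hΨ
    have h := hl _ (Multiset.mem_cons_self _ _)
    exact .lost h.1 h.2 fun e he => hl e (Multiset.mem_cons_of_mem he)

theorem Good.tick {Q : StateName} {Ψ : Multiset Pending} (h : Good p n Q Ψ) :
    Good p n Q (down Ψ) := by
  have key : ∀ x : SimState, x ≠ .init → x ≠ .halt → (∀ e ∈ Ψ, e.time = 0) →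
      Good p n x.code (down Ψ) := fun x hi hh ht =>
    .lost (by simpa using hi) (by simpa using hh) (by simp [down_eq_zero ht])
  cases h with
  | init => exact .init
  | run hs hR => exact key _ (by simp) (by simp) hR.time
  | testSucc hs hR => exact key _ (by simp) (by simp) (by simpa using hR.time)
  | testZero hs hR => exact key _ (by simp) (by simp) (by simpa using hR.time)
  | resume hx hs hR =>
    exact key _ (by rcases hx with rfl | rfl <;> simp) (by rcases hx with rfl | rfl <;> simp)
      (by simpa using hR.time)
  | stuck hx ht =>
    exact key _ (by rcases hx with rfl | rfl <;> simp) (by rcases hx with rfl | rfl <;> simp) ht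
  | lost hi hh hl =>
    refine .lost hi hh fun e he => ?_
    obtain ⟨e', he', -, h⟩ := mem_down he
    exact h ▸ hl e' he'

/-- A configuration is good if its state and pending events are, after a possible state change. -/
def GoodConfig (p : List Instr) (n : ℕ) (c : Config) : Prop :=
  match c.body with
  | none => Good p n c.state c.pending
  | some (Ψ, Q) => Good p n Q (Ψ + c.pending)

theorem GoodConfig.step (hn : ¬ ∃ s, MReach p n p.length s) {c c' : Config} {μ : Label}
    (h : Step (machineContract p n) c μ c') (hc : GoodConfig p n c) : GoodConfig p n c' := by
  cases h with
  | function i F Ψ t hF hΨ =>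
    cases i with
    | zero =>
      obtain rfl : initFun p n = F := by simpa [machineContract] using hF
      exact Good.function_init hc rfl
    | succ i =>
      exact Good.function (mem_machineFuns_iff.1 (List.mem_of_getElem? (i := i) hF)) hc hΨ
  | stateChange => exact hc
  | eventMatch l Q Q' Ψ t =>
    show Good p n Q' (0 + Ψ)
    rw [zero_add]
    exact Good.eventMatch hn hc
  | tick Q Ψ t => exact Good.tick hc

theorem exists_mReach_of_stateReachable
    (h : (machineContract p n).StateReachable SimState.halt.code) :
    ∃ s, MReach p n p.length s := by
  by_contra hn
  obtain ⟨Ψ, t, h⟩ := h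
  have : ∀ c, (machineContract p n).ConfigReachable c → GoodConfig p n c := by
    intro c hc
    induction hc with
    | refl => exact Good.init
    | tail _ h ih => exact GoodConfig.step hn h.choose_spec ih
  exact Good.ne_halt (this _ h) rfl

end Good

/-- Computations of a contract. -/
abbrev Computation (C : Contract) : Config → Config → Prop :=
  ReflTransGen fun c₁ c₂ => ∃ μ, Step C c₁ μ c₂

theorem Computation.call {C : Contract} {F : FunDef} (hF : F ∈ C.functions)
    {Ψ : Multiset Pending} (hΨ : NoRed Ψ F.src) (t : ℕ) :
    ∃ i, Computation C ⟨F.src, none, Ψ, t⟩ ⟨F.tgt, none, C.linecode i F.body + Ψ, t⟩ := by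
  obtain ⟨i, hi⟩ := List.mem_iff_getElem?.1 hF
  exact ⟨i, .tail (.single ⟨_, .function i F Ψ t hi hΨ⟩) ⟨_, .stateChange _ _ _ _ _⟩⟩

theorem Computation.fire (C : Contract) (l : LineCode) (Q Q' : StateName) (Ψ : Multiset Pending)
    (t : ℕ) : Computation C ⟨Q, none, ⟨0, l, Q, Q'⟩ ::ₘ Ψ, t⟩ ⟨Q', none, Ψ, t⟩ := by
  have h := Step.stateChange (C := C) Q Q' 0 Ψ t
  rw [zero_add] at h
  exact .tail (.single ⟨_, .eventMatch l Q Q' Ψ t⟩) ⟨_, h⟩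

theorem computation_of_mStep {p : List Instr} {n : ℕ} {a b : ℕ × Regs} (h : MStep p a b)
    {Ψ : Multiset Pending} (hΨ : Represents p a.2 Ψ) (t : ℕ) :
    ∃ Ψ', Represents p b.2 Ψ' ∧ Computation (machineContract p n)
      ⟨(SimState.pc a.1).code, none, Ψ, t⟩ ⟨(SimState.pc b.1).code, none, Ψ', t⟩ := by
  have hfun : ∀ {F}, IsMachineFun p F → F ∈ (machineContract p n).functions := fun hF =>
    List.mem_cons_of_mem _ (mem_machineFuns_iff.2 hF)
  have hred : ∀ {i ins}, p[i]? = some ins → NoRed Ψ (SimState.pc i).code := fun h =>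
    hΨ.noRed (by simpa using (List.getElem?_eq_some_iff.1 h).1.ne) (by simp)
  cases h with
  | inc h =>
    obtain ⟨k, hk⟩ := Computation.call (hfun (.inc h)) (hred h) t
    exact ⟨_, hΨ.cons_token _ _, hk⟩
  | @decSucc i r q q' s h h0 =>
    obtain ⟨k, hk⟩ := Computation.call (hfun (.decSucc h)) (hred h) t
    obtain ⟨l, Ψ', rfl⟩ := hΨ.exists_token h0
    refine ⟨Ψ', hΨ.of_cons.2.2, hk.trans ?_⟩
    rw [Contract.linecode_singleton, Multiset.singleton_add, Multiset.cons_swap]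
    exact (Computation.fire _ _ _ _ _ _).trans (Computation.fire _ _ _ _ _ _)
  | @decZero i r q q' s h h0 =>
    obtain ⟨k, hk⟩ := Computation.call (hfun (.decZero h)) (hred h) t
    obtain ⟨k', hk'⟩ := Computation.call (hfun (.test h))
      (NoRed.cons (e := ⟨0, _, (SimState.zero r).code, (SimState.pc q').code⟩)
        (hΨ.noRed_dec.2 h0) (by simp)) t
    refine ⟨Ψ, hΨ, hk.trans (hk'.trans ?_)⟩
    rw [Contract.linecode_nil, zero_add]
    exact Computation.fire _ _ _ _ _ _
  | jump h =>
    obtain ⟨k, hk⟩ := Computation.call (hfun (.jump h)) (hred h) t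
    rw [Contract.linecode_nil, zero_add] at hk
    exact ⟨Ψ, hΨ, hk⟩

theorem exists_computation_of_mReach {p : List Instr} {n i : ℕ} {s : Regs} (h : MReach p n i s) :
    ∃ Ψ, Represents p s Ψ ∧
      (machineContract p n).ConfigReachable ⟨(SimState.pc i).code, none, Ψ, 0⟩ := by
  suffices h' : ∀ b, ReflTransGen (MStep p) (0, input n) b → ∃ Ψ, Represents p b.2 Ψ ∧
      (machineContract p n).ConfigReachable ⟨(SimState.pc b.1).code, none, Ψ, 0⟩ from h' _ h
  intro b hb
  induction hb with
  | refl =>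
    refine ⟨_, represents_linecode p n, .tail (.single ⟨_, .function 0 (initFun p n) 0 0 rfl ?_⟩)
      ⟨.silent, ?_⟩⟩
    · simp [NoRed]
    · have h := Step.stateChange (C := machineContract p n) (initFun p n).src (initFun p n).tgt
        ((machineContract p n).linecode 0 (initFun p n).body) 0 0
      rwa [add_zero] at h
  | tail _ h ih =>
    obtain ⟨Ψ, hΨ, hc⟩ := ih
    obtain ⟨Ψ', hΨ', hc'⟩ := computation_of_mStep (n := n) h hΨ 0
    exact ⟨Ψ', hΨ', hc.trans hc'⟩

/-- If the machine halts, then the contract can execute the event that guards its halting state, and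
reach a configuration in which the function of that state can be called. -/
theorem exists_configReachable_of_mReach {p : List Instr} {n : ℕ}
    (h : ∃ s, MReach p n p.length s) : ∃ Ψ, NoRed Ψ SimState.halt.code ∧
      (machineContract p n).ConfigReachable
        ⟨(SimState.pc p.length).code, none, guardEvent p ::ₘ Ψ, 0⟩ ∧
      (machineContract p n).ConfigReachable ⟨SimState.halt.code, none, Ψ, 0⟩ := by
  obtain ⟨s, hs⟩ := h
  obtain ⟨Ψ, hΨ, hc⟩ := exists_computation_of_mReach hs
  obtain ⟨Ψ', rfl⟩ := Multiset.exists_cons_of_mem hΨ.guard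
  exact ⟨Ψ', fun e he => hΨ.noRed (by simp) (by simp) e (Multiset.mem_cons_of_mem he), hc,
    hc.trans (Computation.fire _ _ _ _ _ _)⟩

theorem stateReachable_iff (p : List Instr) (n : ℕ) :
    (machineContract p n).StateReachable SimState.halt.code ↔ ∃ s, MReach p n p.length s := by
  refine ⟨exists_mReach_of_stateReachable, fun h => ?_⟩
  obtain ⟨Ψ, -, -, h⟩ := exists_configReachable_of_mReach h
  exact ⟨Ψ, 0, h⟩

/-- The clause of the function of the halting state. -/
def haltClause : Clause := .func SimState.halt.code 0 SimState.halt.code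

/-- The clause of the event that guards the halting state. -/
def guardClause (p : List Instr) : Clause :=
  .event (SimState.pc p.length).code 0 SimState.halt.code

theorem haltClause_mem (p : List Instr) (n : ℕ) :
    haltClause ∈ (machineContract p n).funClauses :=
  List.mem_map.2 ⟨haltFun, List.mem_cons_of_mem _ (mem_machineFuns_iff.2 .halt), rfl⟩

theorem guardClause_mem (p : List Instr) (n : ℕ) :
    guardClause p ∈ (machineContract p n).eventClauses := by
  simp [Contract.eventClauses, machineContract, initFun, guardClause]

theorem clauseReachable_haltClause_iff (p : List Instr) (n : ℕ) :
    (machineContract p n).ClauseReachable haltClause ↔ ∃ s, MReach p n p.length s := by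
  refine ⟨fun ⟨c₁, c₂, h, hstep, hsrc, _⟩ => ?_, fun h => ?_⟩
  · refine (stateReachable_iff p n).1 ?_
    generalize hμ : Label.func 0 = μ at hstep
    cases hstep with
    | function i F Ψ t =>
      dsimp only at hsrc
      exact ⟨Ψ, t, hsrc ▸ h⟩
    | _ => simp at hμ
  · obtain ⟨Ψ, hΨ, -, h⟩ := exists_configReachable_of_mReach h
    obtain ⟨i, hi⟩ := List.mem_iff_getElem?.1 (show haltFun ∈ (machineContract p n).functions from
      List.mem_cons_of_mem _ (mem_machineFuns_iff.2 .halt))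
    exact ⟨_, _, h, .function i haltFun Ψ 0 hi hΨ, rfl, _, rfl⟩

theorem clauseReachable_guardClause_iff (p : List Instr) (n : ℕ) :
    (machineContract p n).ClauseReachable (guardClause p) ↔ ∃ s, MReach p n p.length s := by
  refine ⟨fun ⟨c₁, c₂, h, hstep, _, Ψ, hb⟩ => ?_, fun h => ?_⟩
  · refine (stateReachable_iff p n).1 ?_
    obtain ⟨Q, b, Ψ', t⟩ := c₂
    dsimp only at hb
    subst hb
    exact ⟨_, t, (ReflTransGen.tail h ⟨_, hstep⟩).tail ⟨_, .stateChange _ _ _ _ _⟩⟩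
  · obtain ⟨Ψ, -, h, -⟩ := exists_configReachable_of_mReach h
    exact ⟨_, _, h, .eventMatch _ _ _ _ _, rfl, _, rfl⟩

end MuStipula
/-! ### Undecidability -/

namespace MuStipula

open Function Relation CounterProgram Nat.Partrec

theorem DecidableOn.computablePred {α β : Type} [Primcodable α] [Primcodable β] {S : Set α}
    {P : α → Prop} (h : DecidableOn S P) {f : β → α} (hf : Computable f) (hS : ∀ b, f b ∈ S) :
    ComputablePred fun b => P (f b) := by
  classical
  obtain ⟨g, hg, hgS⟩ := h
  refine ⟨inferInstance, (hg.comp hf).of_eq fun b => ?_⟩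
  obtain ⟨v, hv, hvP⟩ := hgS (f b) (hS b)
  rw [Part.eq_some_iff.2 hv]
  refine congrArg _ ?_
  by_cases hP : P (f b) <;> simp [hP] at hvP ⊢ <;> exact hvP

theorem computable_machineContract (p : List Instr) : Computable (machineContract p) := by
  have hrep : Primrec fun n : ℕ => List.replicate n (tokenDef 0) := by
    refine (Primrec.list_map Primrec.list_range (Primrec.const (tokenDef 0)).to₂).of_eq fun n => ?_
    simp [List.map_const']
  have hbody : Primrec fun n : ℕ => (initFun p n).body :=
    Primrec.list_cons.comp (Primrec.const _) hrep
  have hfun : Primrec (initFun p) :=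
    (Primrec.of_equiv_symm (e := FunDef.equivTuple)).comp ((Primrec.const SimState.init.code).pair
      ((Primrec.const 0).pair (hbody.pair (Primrec.const (SimState.pc 0).code))))
  exact ((Primrec.of_equiv_symm (e := Contract.equivTuple)).comp
    ((Primrec.const SimState.init.code).pair
      (Primrec.list_cons.comp hfun (Primrec.const (machineFuns p))))).to_comp

/-- There is a counter machine with an undecidable halting problem. -/
theorem exists_machine_not_computablePred :
    ∃ p : List Instr, ¬ ComputablePred fun n => ∃ s, MReach p n p.length s := by
  let g : ℕ → ℕ → ℕ := fun a k =>
    if (Code.evaln k (Denumerable.ofNat Code a) 0).isSome then 0 else 1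
  have hg : Primrec₂ g := by
    refine Primrec.ite ?_ (Primrec.const _) (Primrec.const _)
    refine Primrec.eq.comp (Primrec.option_isSome.comp (Code.primrec_evaln.comp
      ((Primrec.snd.pair ((Primrec.ofNat Code).comp Primrec.fst)).pair (Primrec.const 0))))
      (Primrec.const true)
  obtain ⟨p, hp⟩ := exists_machine hg
  refine ⟨p, fun h => ComputablePred.halting_problem 0 ?_⟩
  refine ComputablePred.computable_of_manyOneReducible ⟨_, Computable.encode, fun c => ?_⟩ h
  refine Iff.trans ?_ (hp _).symm
  simp only [g, Denumerable.ofNat_encode, ite_eq_left_iff, one_ne_zero, imp_false, not_not,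
    Option.isSome_iff_exists, Part.dom_iff_mem]
  constructor
  · rintro ⟨x, hx⟩
    obtain ⟨k, hk⟩ := Code.evaln_complete.1 hx
    exact ⟨k, x, hk⟩
  · rintro ⟨k, x, hk⟩
    exact ⟨x, Code.evaln_sound hk⟩

end MuStipula

theorem mainTheorem1 :
    -- state reachability
    (¬ MuStipula.DecidableOn
      {p : MuStipula.Contract × MuStipula.StateName | p.1 ∈ MuStipula.InstantaneousContracts}
      (fun p => p.1.StateReachable p.2)) ∧
    -- clause reachability
    (¬ MuStipula.DecidableOn
      {p : MuStipula.Contract × MuStipula.Clause | p.1 ∈ MuStipula.InstantaneousContracts ∧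
        (p.2 ∈ p.1.funClauses ∨ p.2 ∈ p.1.eventClauses)}
      (fun p => p.1.ClauseReachable p.2)) ∧
    -- clause reachability, restricted to functions
    (¬ MuStipula.DecidableOn
      {p : MuStipula.Contract × MuStipula.Clause | p.1 ∈ MuStipula.InstantaneousContracts ∧
        p.2 ∈ p.1.funClauses}
      (fun p => p.1.ClauseReachable p.2)) ∧
    -- clause reachability, restricted to events
    (¬ MuStipula.DecidableOn
      {p : MuStipula.Contract × MuStipula.Clause | p.1 ∈ MuStipula.InstantaneousContracts ∧
        p.2 ∈ p.1.eventClauses}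
      (fun p => p.1.ClauseReachable p.2)) := by
  obtain ⟨p, hp⟩ := MuStipula.exists_machine_not_computablePred
  have hcomp := MuStipula.computable_machineContract p
  have hmem := MuStipula.machineContract_mem p
  have hhalt := MuStipula.haltClause_mem p
  have hguard := MuStipula.guardClause_mem p
  have hc₁ := hcomp.pair (Computable.const MuStipula.haltClause)
  have hc₂ := hcomp.pair (Computable.const (MuStipula.guardClause p))
  have iff₁ := MuStipula.clauseReachable_haltClause_iff p
  refine ⟨fun h => hp ?_, fun h => hp ?_, fun h => hp ?_, fun h => hp ?_⟩
  · exact (h.computablePred (hcomp.pair (Computable.const MuStipula.SimState.halt.code)) hmem).of_eq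
      (MuStipula.stateReachable_iff p)
  · exact (h.computablePred hc₁ fun n => ⟨hmem n, .inl (hhalt n)⟩).of_eq iff₁
  · exact (h.computablePred hc₁ fun n => ⟨hmem n, hhalt n⟩).of_eq iff₁
  · exact (h.computablePred hc₂ fun n => ⟨hmem n, hguard n⟩).of_eq
      (MuStipula.clauseReachable_guardClause_iff p)
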